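/- Let $K$ be a field, $R=K[x_1,\dots,x_n]$, and let $\succ$ be an admissible monomial ordering on $R$ with $x_1\succ x_2\succ\dots\succ x_n$; $lm(f)$ denotes the leading monomial of a nonzero polynomial $f$, and $lm(F)=\{lm(f): f\in F\}$. *Separation of variables.* For a monomial $u\neq 1$ let $k$ be the largest index such that $x_k$ divides $u$; the variables $x_j$ with $j\ge k$ are Pommaret multiplicative for $u$, the others are not; for $u=1$ all variables are Pommaret multiplicative. For a set of monomials $U$ and $u\in U$, the variable $x_i$ is Janet multiplicative for $u$ in $U$ if $\deg_i(u)\ge\deg_i(v)$ for all $v\in U$ with $\deg_j(v)=\deg_j(u)$ for all $j<i$. A monomial $u$ is a Pommaret (resp., for $u\in U$, Janet with respect to $U$) divisor of $w$ if $u\mid w$ and $w/u$ contains only Pommaret (resp. Janet) multiplicative variables of $u$. For polynomials these notions are applied to leading monomials, with $U=lm(F)$ for elements of $F$. *Reduction.* A Pommaret (Janet) reduction of $g$ modulo $F$ cancels a term of $g$ with monomial $t$ by subtracting a term multiple of some nonzero $f\in F$ whose leading monomial is a Pommaret (Janet, with respect to $lm(F)$) divisor of $t$. A Pommaret (Janet)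 normal form of $g$ modulo $F$ is a polynomial obtained from $g$ by finitely many such reductions, none of whose terms has a Pommaret (Janet) divisor in $lm(F)$. *Bases.* A set $F$ of nonzero polynomials with pairwise distinct leading monomials (finite in the Janet case, possibly infinite in the Pommaret case) is Pommaret (Janet) autoreduced if no term of any $f\in F$ has a Pommaret (Janet, with respect to $lm(F)$) divisor in $lm(F)\setminus\{lm(f)\}$. It is a Pommaret (Janet) basis of the ideal $I$ it generates if it is Pommaret (Janet) autoreduced and, for every $f\in F$ and every variable $x$ that is not Pommaret (Janet) multiplicative for $f$, the product $f\cdot x$ has Pommaret (Janet) normal form $0$ modulo $F$. A Janet basis $G$ of $I$ is minimal if $lm(G)\subseteq lm(F)$ for every Janet basis $F$ of $I$. *Pommaret–Janet autoreduction* of a finite set $F$ of nonzero polynomials. Put $G:=\emptyset$, $H:=F$. Repeat the following pass until it leaves $H$ unchanged: first, while there is $h\in H$ such that $lm(h)$ is a Pommaret multiple of an element of $lm(H\setminus\{h\})$, move $h$ from $H$ to $G$; then, as long as $G\ne\emptyset$, remove some $g$ from $G$, compute a Janet normal form $f$ of $g$ modulo $H$, and add $f$ to $H$ if $f\ne 0$.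 Finally, Janet autoreduce $H$, that is, repeatedly reduce terms of elements $h\in H$ by elements of $H\setminus\{h\}$ whose leading monomials are Janet divisors of them with respect to $lm(H)$, discarding zeros, until the set is Janet autoreduced. **Theorem 1.** Let $I\subseteq R$ be an ideal. Then $I$ has a minimal Janet basis, the Pommaret–Janet autoreduction of every Janet basis of $I$ has exactly one possible output, and the following are equivalent: (i) $I$ has a finite Pommaret basis; (ii) every minimal Janet basis of $I$ is a Pommaret basis of $I$; (iii) for every Janet basis $F$ of $I$, the Pommaret–Janet autoreduction of $F$ is a Pommaret basis of $I$. -/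

import Mathlib

open scoped MonomialOrder

namespace Involutive

/-!
Monomials in the variables `x_1, …, x_n` are identified with their exponent vectors
`u : Fin n →₀ ℕ` (the index `0` stands for `x_1`), so multiplication of monomials is addition.
-/

variable {n : ℕ} {K : Type*} [Field K]

/-! ### Separation of variables -/

/-- `x_i` is Pommaret multiplicative for the monomial `u`: no variable `x_j` with `j > i`
occurs in `u`. (For `u = 1` all variables are multiplicative.) -/
def PommaretMult (u : Fin n →₀ ℕ) (i : Fin n) : Prop :=
  ∀ j ∈ u.support, j ≤ i

/-- `x_i` is Janet multiplicative for `u` as an element of `U`: the degree of `u` in `x_i` is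
maximal among all `v ∈ U` having the same degrees as `u` in `x_1, …, x_{i-1}`. -/
def JanetMult (U : Set (Fin n →₀ ℕ)) (u : Fin n →₀ ℕ) (i : Fin n) : Prop :=
  ∀ v ∈ U, (∀ j < i, v j = u j) → v i ≤ u i

/-- `u` is a Pommaret divisor of `w`: `w = u * s` with `s` a monomial in the Pommaret
multiplicative variables of `u`. -/
def PommaretDvd (u w : Fin n →₀ ℕ) : Prop :=
  ∃ s : Fin n →₀ ℕ, w = u + s ∧ ∀ i ∈ s.support, PommaretMult u i

/-- The element `u` of `U` is a Janet divisor of `w`: `w = u * s` with `s` a monomial in the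
Janet multiplicative variables of `u ∈ U`. -/
def JanetDvd (U : Set (Fin n →₀ ℕ)) (u w : Fin n →₀ ℕ) : Prop :=
  u ∈ U ∧ ∃ s : Fin n →₀ ℕ, w = u + s ∧ ∀ i ∈ s.support, JanetMult U u i

/-- The Pommaret cone of a set of monomials: all Pommaret multiples of its elements. -/
def pommaretCone (U : Set (Fin n →₀ ℕ)) : Set (Fin n →₀ ℕ) :=
  {w | ∃ u ∈ U, PommaretDvd u w}

/-! ### Reductions and normal forms -/

/-- The set of leading monomials of the nonzero elements of `F`. -/
def lmSet (m : MonomialOrder (Fin n)) (F : Set (MvPolynomial (Fin n) K)) :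
    Set (Fin n →₀ ℕ) :=
  {u | ∃ f ∈ F, f ≠ 0 ∧ m.degree f = u}

/-- One elementary reduction of `g` to `g'` by an element of `F`, with respect to the divisibility
relation `D` on monomials: a term of `g` with monomial `t` is cancelled by means of some `f ∈ F`
whose leading monomial is a `D`-divisor of `t`. -/
def ReducesTo (m : MonomialOrder (Fin n)) (D : (Fin n →₀ ℕ) → (Fin n →₀ ℕ) → Prop)
    (F : Set (MvPolynomial (Fin n) K)) (g g' : MvPolynomial (Fin n) K) : Prop :=
  ∃ f ∈ F, f ≠ 0 ∧ ∃ t ∈ g.support, D (m.degree f) t ∧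
    g' = g - MvPolynomial.monomial (t - m.degree f) (g.coeff t / m.leadingCoeff f) * f

/-- `h` is a normal form of `g` modulo `F`: it is reached from `g` by finitely many elementary
reductions, and no term of `h` has a `D`-divisor among the leading monomials of `F`. -/
def IsNormalForm (m : MonomialOrder (Fin n)) (D : (Fin n →₀ ℕ) → (Fin n →₀ ℕ) → Prop)
    (F : Set (MvPolynomial (Fin n) K)) (g h : MvPolynomial (Fin n) K) : Prop :=
  Relation.ReflTransGen (ReducesTo m D F) g h ∧
    ∀ t ∈ h.support, ∀ u ∈ lmSet m F, ¬ D u t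

/-- `h` is a Pommaret normal form of `g` modulo `F`. -/
def IsPommaretNF (m : MonomialOrder (Fin n)) (F : Set (MvPolynomial (Fin n) K))
    (g h : MvPolynomial (Fin n) K) : Prop :=
  IsNormalForm m PommaretDvd F g h

/-- `h` is a Janet normal form of `g` modulo `F`. -/
def IsJanetNF (m : MonomialOrder (Fin n)) (F : Set (MvPolynomial (Fin n) K))
    (g h : MvPolynomial (Fin n) K) : Prop :=
  IsNormalForm m (JanetDvd (lmSet m F)) F g h

/-! ### Autoreduced sets and bases -/

/-- A (possibly infinite) set of nonzero polynomials with pairwise distinct leading monomials is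
Pommaret autoreduced if no term of any `f ∈ F` is a Pommaret multiple of a leading monomial of `F`
other than that of `f`. -/
def IsPommaretAutoreduced (m : MonomialOrder (Fin n)) (F : Set (MvPolynomial (Fin n) K)) :
    Prop :=
  (∀ f ∈ F, f ≠ 0) ∧ Set.InjOn m.degree F ∧
    ∀ f ∈ F, ∀ t ∈ f.support, ∀ u ∈ lmSet m F, u ≠ m.degree f → ¬ PommaretDvd u t

/-- A finite set of nonzero polynomials with pairwise distinct leading monomials is Janet
autoreduced if no term of any `f ∈ F` has a Janet divisor among the leading monomials of `F`
other than that of `f`. -/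
def IsJanetAutoreduced (m : MonomialOrder (Fin n)) (F : Set (MvPolynomial (Fin n) K)) :
    Prop :=
  F.Finite ∧ (∀ f ∈ F, f ≠ 0) ∧ Set.InjOn m.degree F ∧
    ∀ f ∈ F, ∀ t ∈ f.support, ∀ u ∈ lmSet m F, u ≠ m.degree f →
      ¬ JanetDvd (lmSet m F) u t

/-- `F` is a (possibly infinite) Pommaret basis of the ideal `I`. -/
def IsPommaretBasis (m : MonomialOrder (Fin n)) (I : Ideal (MvPolynomial (Fin n) K))
    (F : Set (MvPolynomial (Fin n) K)) : Prop :=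
  IsPommaretAutoreduced m F ∧ Ideal.span F = I ∧
    ∀ f ∈ F, ∀ i : Fin n, ¬ PommaretMult (m.degree f) i →
      IsPommaretNF m F (f * MvPolynomial.X i) 0

/-- `F` is a Janet basis of the ideal `I`. -/
def IsJanetBasis (m : MonomialOrder (Fin n)) (I : Ideal (MvPolynomial (Fin n) K))
    (F : Set (MvPolynomial (Fin n) K)) : Prop :=
  IsJanetAutoreduced m F ∧ Ideal.span F = I ∧
    ∀ f ∈ F, ∀ i : Fin n, ¬ JanetMult (lmSet m F) (m.degree f) i →
      IsJanetNF m F (f * MvPolynomial.X i) 0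

/-- `G` is a minimal Janet basis of the ideal `I`. -/
def IsMinimalJanetBasis (m : MonomialOrder (Fin n)) (I : Ideal (MvPolynomial (Fin n) K))
    (G : Set (MvPolynomial (Fin n) K)) : Prop :=
  IsJanetBasis m I G ∧ ∀ F, IsJanetBasis m I F → lmSet m G ⊆ lmSet m F

/-! ### Pommaret–Janet autoreduction

The algorithm makes arbitrary choices, so it is given as a relation between its input and its
possible outputs. A state of its two inner loops is a pair `(G, H)` of sets of polynomials. -/

/-- One step of Janet autoreduction: one term of some `h ∈ H` is reduced by another element of
`H`, with the Janet separation of variables taken with respect to `H`; a zero result is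
discarded. -/
def JanetAutoreduceStep (m : MonomialOrder (Fin n)) (H H' : Set (MvPolynomial (Fin n) K)) :
    Prop :=
  ∃ h ∈ H, ∃ h', ReducesTo m (JanetDvd (lmSet m H)) (H \ {h}) h h' ∧
    H' = (H \ {h}) ∪ ({h'} \ {0})

/-- `H'` is a result of Janet autoreduction of `H`. -/
def IsJanetAutoreduction (m : MonomialOrder (Fin n)) (H H' : Set (MvPolynomial (Fin n) K)) :
    Prop :=
  Relation.ReflTransGen (JanetAutoreduceStep m) H H' ∧ IsJanetAutoreduced m H'

/-- One pass of the while-loop: an element `h ∈ H` whose leading monomial is in the Pommaret cone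
of the leading monomials of `H \ {h}` is moved from `H` to `G`. -/
def WhileStep (m : MonomialOrder (Fin n))
    (s s' : Set (MvPolynomial (Fin n) K) × Set (MvPolynomial (Fin n) K)) : Prop :=
  ∃ h ∈ s.2, m.degree h ∈ pommaretCone (lmSet m (s.2 \ {h})) ∧
    s' = (s.1 ∪ {h}, s.2 \ {h})

/-- The while-loop, executed until no further pass is possible. -/
def WhileLoop (m : MonomialOrder (Fin n))
    (s s' : Set (MvPolynomial (Fin n) K) × Set (MvPolynomial (Fin n) K)) : Prop :=
  Relation.ReflTransGen (WhileStep m) s s' ∧ ∀ s'', ¬ WhileStep m s' s''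

/-- One pass of the for-loop: an element `g` is removed from `G`, and its Janet normal form modulo
the current `H` is added to `H` if it is nonzero. -/
def ForStep (m : MonomialOrder (Fin n))
    (s s' : Set (MvPolynomial (Fin n) K) × Set (MvPolynomial (Fin n) K)) : Prop :=
  ∃ g ∈ s.1, ∃ f, IsJanetNF m s.2 g f ∧ s' = (s.1 \ {g}, s.2 ∪ ({f} \ {0}))

/-- One pass of the repeat-loop: it transforms `H` into `H'`, starting and ending with
`G = ∅`. -/
def RepeatBody (m : MonomialOrder (Fin n)) (H H' : Set (MvPolynomial (Fin n) K)) : Prop :=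
  ∃ s : Set (MvPolynomial (Fin n) K) × Set (MvPolynomial (Fin n) K),
    WhileLoop m (∅, H) s ∧ Relation.ReflTransGen (ForStep m) s (∅, H')

/-- The repeat-loop: its body is executed until it leaves `H` unchanged. -/
inductive RepeatLoop (m : MonomialOrder (Fin n)) :
    Set (MvPolynomial (Fin n) K) → Set (MvPolynomial (Fin n) K) → Prop
  | done {H : Set (MvPolynomial (Fin n) K)} : RepeatBody m H H → RepeatLoop m H H
  | again {H H₁ H₂ : Set (MvPolynomial (Fin n) K)} :
      RepeatBody m H H₁ → H₁ ≠ H → RepeatLoop m H₁ H₂ → RepeatLoop m H H₂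

/-- `H` is an output of the Pommaret–Janet autoreduction of the finite set `F` of nonzero
polynomials: the repeat-loop followed by Janet autoreduction. -/
def IsPJAutoreduction (m : MonomialOrder (Fin n)) (F H : Set (MvPolynomial (Fin n) K)) :
    Prop :=
  ∃ H₁, RepeatLoop m F H₁ ∧ IsJanetAutoreduction m H₁ H

end Involutive

namespace Involutive

variable {n : ℕ}

/-! ### Combinatorics of Pommaret and Janet division -/

/-! The argument takes place on the monomials of lm(I), through finite sets of elements of I with
distinct leading monomials whose Janet cones cover lm(I) (`IsJanetSpanning`: a Janet basis without
the condition on tails). Every Janet basis is such a set: replacing nonmultiplicative prolongations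
by their reductions terminates by continuity (`JanetDvd.toLex_lt`), and uniqueness of Janet divisors
keeps leading terms from cancelling. Conversely, Janet autoreduction turns such a set into a Janet
basis with the same leading monomials, and the result is unique.

For a minimal Janet basis, `minimalJanetSet` is built from lm(I) alone; it is finite, its Janet
cones cover lm(I), and it lies in every subset of lm(I) whose Janet cones do.

For Pommaret–Janet autoreduction, `JanetDvd.of_pommaretDvd` shows that the Pommaret-minimal elements
of a covering set still cover. So the while-loop ends there whatever the choices, the moved elements
have Janet normal form 0, and only Janet autoreduction remains. By the same fact a minimal Janet
basis has no Pommaret divisibility between distinct leading monomials.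

Finally, the Pommaret cones of a finite Pommaret basis cover lm(I), and this forces Janet and
Pommaret multiplicative variables to agree on every covering, Pommaret autoreduced set of leading
monomials (`JanetMult.pommaretMult`). Hence (i) implies (ii) and (iii). The converses hold because
Janet bases are finite. -/

lemma pommaretDvd_iff {u w : Fin n →₀ ℕ} :
    PommaretDvd u w ↔ u ≤ w ∧ ∀ i, u i < w i → PommaretMult u i := by
  constructor
  · rintro ⟨s, rfl, hs⟩
    refine ⟨le_self_add, fun i hi => hs i ?_⟩
    simp only [Finsupp.add_apply] at hi
    simp only [Finsupp.mem_support_iff]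
    omega
  · rintro ⟨h, hm⟩
    refine ⟨w - u, (add_tsub_cancel_of_le h).symm, fun i hi => hm i ?_⟩
    simp only [Finsupp.mem_support_iff, Finsupp.tsub_apply] at hi
    omega

lemma janetDvd_iff {U : Set (Fin n →₀ ℕ)} {u w : Fin n →₀ ℕ} :
    JanetDvd U u w ↔ u ∈ U ∧ u ≤ w ∧ ∀ i, u i < w i → JanetMult U u i := by
  refine and_congr_right fun _ => ⟨?_, ?_⟩
  · rintro ⟨s, rfl, hs⟩
    refine ⟨le_self_add, fun i hi => hs i ?_⟩
    simp only [Finsupp.add_apply] at hi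
    simp only [Finsupp.mem_support_iff]
    omega
  · rintro ⟨h, hm⟩
    refine ⟨w - u, (add_tsub_cancel_of_le h).symm, fun i hi => hm i ?_⟩
    simp only [Finsupp.mem_support_iff, Finsupp.tsub_apply] at hi
    omega

lemma PommaretDvd.le {u w : Fin n →₀ ℕ} (h : PommaretDvd u w) : u ≤ w :=
  (pommaretDvd_iff.1 h).1

lemma JanetDvd.mem {U : Set (Fin n →₀ ℕ)} {u w : Fin n →₀ ℕ} (h : JanetDvd U u w) : u ∈ U :=
  h.1

lemma JanetDvd.le {U : Set (Fin n →₀ ℕ)} {u w : Fin n →₀ ℕ} (h : JanetDvd U u w) : u ≤ w :=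
  (janetDvd_iff.1 h).2.1

lemma JanetDvd.mult {U : Set (Fin n →₀ ℕ)} {u w : Fin n →₀ ℕ} (h : JanetDvd U u w) {i : Fin n}
    (hi : u i < w i) : JanetMult U u i :=
  (janetDvd_iff.1 h).2.2 i hi

lemma pommaretDvd_refl (u : Fin n →₀ ℕ) : PommaretDvd u u :=
  pommaretDvd_iff.2 ⟨le_rfl, fun _ h => (lt_irrefl _ h).elim⟩

lemma janetDvd_refl {U : Set (Fin n →₀ ℕ)} {u : Fin n →₀ ℕ} (hu : u ∈ U) : JanetDvd U u u :=
  janetDvd_iff.2 ⟨hu, le_rfl, fun _ h => (lt_irrefl _ h).elim⟩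

lemma PommaretDvd.trans {u v w : Fin n →₀ ℕ} (h₁ : PommaretDvd u v) (h₂ : PommaretDvd v w) :
    PommaretDvd u w := by
  rw [pommaretDvd_iff] at *
  refine ⟨h₁.1.trans h₂.1, fun i hi => ?_⟩
  by_cases h : u i < v i
  · exact h₁.2 i h
  · intro j hj
    refine h₂.2 i (by omega) j ?_
    have := h₁.1 j
    simp only [Finsupp.mem_support_iff] at hj ⊢
    omega

lemma PommaretDvd.antisymm {u v : Fin n →₀ ℕ} (h₁ : PommaretDvd u v) (h₂ : PommaretDvd v u) :
    u = v :=
  le_antisymm h₁.le h₂.le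

/-- A Janet divisor of `w` agrees with `v ∈ U` as long as `v` agrees with `w`. -/
lemma JanetDvd.eq_of_agree {U : Set (Fin n →₀ ℕ)} {q v w : Fin n →₀ ℕ} (hq : JanetDvd U q w)
    (hv : v ∈ U) {i : Fin n} (h : ∀ j < i, w j = v j) : ∀ j < i, q j = v j := by
  intro j
  induction j using WellFoundedLT.induction with
  | ind j ih =>
    intro hj
    by_contra hne
    have h1 := hq.le j
    have h2 := h j hj
    have := hq.mult (i := j) (by omega) v hv fun k hk => (ih k hk (hk.trans hj)).symm
    omega

lemma exists_first_ne {u v : Fin n →₀ ℕ} (h : u ≠ v) :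
    ∃ i, u i ≠ v i ∧ ∀ j < i, u j = v j := by
  have h' : ∃ i, u i ≠ v i := by
    by_contra hc
    push Not at hc
    exact h (Finsupp.ext hc)
  obtain ⟨i, hi, hmin⟩ := WellFounded.has_min (r := ((· < ·) : Fin n → Fin n → Prop))
    wellFounded_lt {i | u i ≠ v i} h'
  exact ⟨i, hi, fun j hj => by_contra fun hne => hmin j hne hj⟩

/-- At the first variable where two Janet divisors differ, the one of smaller degree must be
multiplied by a variable in which the other beats it. -/
lemma JanetDvd.unique {U : Set (Fin n →₀ ℕ)} {u v w : Fin n →₀ ℕ} (hu : JanetDvd U u w)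
    (hv : JanetDvd U v w) : u = v := by
  by_contra hne
  obtain ⟨i, hi, hlt⟩ := exists_first_ne hne
  have h1 := hu.le i
  have h2 := hv.le i
  rcases lt_or_gt_of_ne hi with h | h
  · have := hu.mult (i := i) (by omega) v hv.mem fun j hj => (hlt j hj).symm
    omega
  · have := hv.mult (i := i) (by omega) u hu.mem hlt
    omega

/-- In a Pommaret autoreduced set, Pommaret multiplicative variables are Janet multiplicative. -/
lemma PommaretMult.janetMult {U : Set (Fin n →₀ ℕ)} {u : Fin n →₀ ℕ}
    (hU : ∀ v ∈ U, PommaretDvd u v → u = v) {i : Fin n} (hi : PommaretMult u i) :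
    JanetMult U u i := by
  intro v hv hvu
  by_contra! hlt
  have h0 : ∀ j, i < j → u j = 0 := fun j hj => by
    by_contra h
    exact absurd (hi j (Finsupp.mem_support_iff.2 h)) (not_le.2 hj)
  -- Since `u` involves no variable after `i`, beating `u` at `i` with equal earlier degrees makes
  -- `v` a Pommaret multiple of `u`.
  have : u = v := by
    refine hU v hv (pommaretDvd_iff.2 ⟨fun j => ?_, fun j hj k hk => ?_⟩)
    · rcases lt_trichotomy j i with h | rfl | h
      · exact (hvu j h).ge
      · exact hlt.le
      · simp [h0 j h]
    · have : i ≤ j := by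
        by_contra! h
        have := hvu j h
        omega
      exact (hi k hk).trans this
  rw [this] at hlt
  exact lt_irrefl _ hlt

/-- Replacing a Janet divisor `u ∈ U` by one of its Pommaret divisors in a Pommaret autoreduced
subset `V ⊆ U` yields a Janet divisor with respect to `V`. -/
lemma JanetDvd.of_pommaretDvd {U V : Set (Fin n →₀ ℕ)} (hVU : V ⊆ U)
    (hV : ∀ u ∈ V, ∀ v ∈ V, PommaretDvd u v → u = v) {u v w : Fin n →₀ ℕ} (hv : v ∈ V)
    (hvu : PommaretDvd v u) (hu : JanetDvd U u w) : JanetDvd V v w := by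
  have hle := hvu.le.trans hu.le
  refine janetDvd_iff.2 ⟨hv, hle, fun i hi => ?_⟩
  by_cases hp : PommaretMult v i
  · exact hp.janetMult (hV v hv)
  -- If `v` and `u` differed at some `j ≤ i`, then `x_j`, and hence `x_i`, would be Pommaret
  -- multiplicative for `v`. So they agree up to `i`, and `v` inherits multiplicativity from `u`.
  · have hag : ∀ j ≤ i, v j = u j := by
      intro j hj
      by_contra hne
      have := hvu.le j
      refine hp fun k hk => ((pommaretDvd_iff.1 hvu).2 j (by omega) k hk).trans hj
    have := hag i le_rfl
    intro x hx hxv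
    rw [this]
    exact hu.mult (by omega) x (hVU hx) fun j hj => (hxv j hj).trans (hag j hj.le)

/-- Continuity of Janet division: a Janet divisor of a nonmultiplicative prolongation of `u` is
lexicographically larger than `u`. -/
lemma JanetDvd.toLex_lt {U : Set (Fin n →₀ ℕ)} {u q : Fin n →₀ ℕ} (hu : u ∈ U) {i : Fin n}
    (hi : ¬ JanetMult U u i) (hq : JanetDvd U q (u + Finsupp.single i 1)) :
    toLex u < toLex q := by
  have hpre : ∀ j < i, q j = u j :=
    hq.eq_of_agree hu fun j hj => by simp [Finsupp.single_eq_of_ne hj.ne]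
  refine Finsupp.Lex.lt_iff.2 ⟨i, fun j hj => (hpre j hj).symm, ?_⟩
  by_contra! hle
  have hle' : q i ≤ u i := hle
  obtain ⟨v, hv, hvu, hlt⟩ : ∃ v ∈ U, (∀ j < i, v j = u j) ∧ u i < v i := by
    unfold JanetMult at hi
    push Not at hi
    exact hi
  have := hq.mult (i := i) (by simp; omega) v hv fun j hj => (hvu j hj).trans (hpre j hj).symm
  omega

/-! ### The minimal Janet complete set of a monomial ideal -/

/-- The set of monomials of the minimal Janet basis of the monomial ideal `L`. -/
def minimalJanetSet (L : Set (Fin n →₀ ℕ)) : Set (Fin n →₀ ℕ) :=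
  {u | u ∈ L ∧ ∀ i, 0 < u i →
    ∃ v ∈ L, (∀ j < i, v j = u j) ∧ u i ≤ v i ∧ v - Finsupp.single i 1 ∉ L}

/-- By Dickson's lemma `L` has finitely many minimal generators. Once `v i` exceeds all their
degrees, the generator dividing `v` still divides `v / x_i`. If `v i = 0`, truncated subtraction
returns `v` itself, so the hypothesis fails. -/
lemma exists_bound_of_isUpperSet {L : Set (Fin n →₀ ℕ)} (hL : IsUpperSet L) :
    ∃ B : ℕ, ∀ v ∈ L, ∀ i, v - Finsupp.single i 1 ∉ L → v i ≤ B := by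
  have hfin : {u | Minimal (· ∈ L) u}.Finite :=
    (setOfPred_minimal_antichain (· ∈ L)).finite_of_wellQuasiOrdered wellQuasiOrdered_le
  obtain ⟨B, hB⟩ := (hfin.image fun u => u.degree).bddAbove
  refine ⟨B, fun v hv i hi => ?_⟩
  obtain ⟨g, hgv, hg⟩ := exists_minimal_le_of_wellFoundedLT (· ∈ L) v hv
  have h1 : g.degree ≤ B := hB ⟨g, hg, rfl⟩
  have h2 : g i ≤ g.degree := Finsupp.le_degree i g
  by_contra! hlt
  refine hi (hL (a := g) (fun j => ?_) hg.1)
  have := hgv j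
  by_cases hj : j = i
  · subst hj
    simp
    omega
  · simpa [Finsupp.single_eq_of_ne hj] using this

lemma minimalJanetSet_finite {L : Set (Fin n →₀ ℕ)} (hL : IsUpperSet L) :
    (minimalJanetSet L).Finite := by
  obtain ⟨B, hB⟩ := exists_bound_of_isUpperSet hL
  refine (Set.finite_Icc 0 (Finsupp.equivFunOnFinite.symm fun _ : Fin n => B)).subset ?_
  intro u hu
  refine ⟨zero_le, fun i => ?_⟩
  change u i ≤ B
  rcases Nat.eq_zero_or_pos (u i) with h | h
  · omega
  · obtain ⟨v, hv, -, hle, hn⟩ := hu.2 i h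
    exact hle.trans (hB v hv i hn)

/-- Among the divisors of `w` in `L` satisfying the condition `S`, which makes every variable of `w
/ u` Janet multiplicative, a minimal one works: if some exponent were not forced in the sense of
`minimalJanetSet`, lowering it by one would stay in `S`. -/
lemma exists_janetDvd_minimalJanetSet {L : Set (Fin n →₀ ℕ)} (hL : IsUpperSet L)
    {w : Fin n →₀ ℕ} (hw : w ∈ L) :
    ∃ u, JanetDvd (minimalJanetSet L) u w := by
  let S : Set (Fin n →₀ ℕ) := {u | u ∈ L ∧ u ≤ w ∧ ∀ i, u i < w i →
    ∀ v ∈ L, (∀ j < i, v j = u j) → u i < v i → v - Finsupp.single i 1 ∈ L}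
  have hwS : w ∈ S := ⟨hw, le_rfl, fun i hi => (lt_irrefl _ hi).elim⟩
  obtain ⟨u, -, hu⟩ := exists_minimal_le_of_wellFoundedLT (· ∈ S) w hwS
  obtain ⟨⟨huL, huw, hmult⟩, hmin⟩ := hu
  refine ⟨u, janetDvd_iff.2 ⟨⟨huL, fun i hi => ?_⟩, huw, fun i hi v hv hvu => ?_⟩⟩
  · by_contra! hc
    have hlt : u - Finsupp.single i 1 < u := by
      refine lt_of_le_of_ne tsub_le_self fun h => ?_
      have := DFunLike.congr_fun h i
      simp at this
      omega
    refine not_le_of_gt hlt (hmin (y := u - Finsupp.single i 1) ?_ hlt.le)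
    refine ⟨hc u huL (fun _ _ => rfl) le_rfl, tsub_le_self.trans huw, fun j hj v hv hvu hvj => ?_⟩
    rcases lt_trichotomy j i with h | rfl | h
    · simp only [Finsupp.tsub_apply, Finsupp.single_eq_of_ne h.ne, tsub_zero] at hj hvj
      refine hmult j hj v hv (fun k hk => ?_) hvj
      rw [hvu k hk]
      simp [Finsupp.single_eq_of_ne (hk.trans h).ne]
    · simp only [Finsupp.tsub_apply, Finsupp.single_eq_same] at hvj
      refine hc v hv (fun k hk => ?_) (by omega)
      rw [hvu k hk]
      simp [Finsupp.single_eq_of_ne hk.ne]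
    -- Here `v` has degree `u i - 1` in `x_i`: multiply by `x_i` to match `u`, divide by `x_j` using
    -- `hmult`, then remove `x_i` again using `hc`.
    · simp only [Finsupp.tsub_apply, Finsupp.single_eq_of_ne h.ne', tsub_zero] at hj hvj
      have hvi := hvu i h
      simp only [Finsupp.tsub_apply, Finsupp.single_eq_same] at hvi
      have h1 : v + Finsupp.single i 1 - Finsupp.single j 1 ∈ L := by
        refine hmult j hj _ (hL le_self_add hv) (fun k hk => ?_) ?_
        · by_cases hki : k = i
          · subst hki
            simp
            omega
          · simp [hvu k hk, Finsupp.single_eq_of_ne hki]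
        · simpa [Finsupp.single_eq_of_ne h.ne'] using hvj
      have h2 := hc _ h1 (fun k hk => ?_) ?_
      · rwa [tsub_right_comm, add_tsub_cancel_right] at h2
      · have hki : k ≠ i := hk.ne
        simp [hvu k (hk.trans h), Finsupp.single_eq_of_ne hki,
          Finsupp.single_eq_of_ne (hk.trans h).ne]
      · simp [Finsupp.single_eq_of_ne h.ne]
        omega
  · by_contra! hlt
    obtain ⟨v', hv', hag, hle, hn⟩ := hv.2 i (by omega)
    exact hn (hmult i hi v' hv' (fun j hj => (hag j hj).trans (hvu j hj)) (by omega))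

/-- If the Janet divisor `q ∈ U` of `u` first falls short at `i`, take the witness `v` forcing `u
i`. The Janet divisor `p` of `v` agrees with `q` before `i`, so `p i ≤ q i < v i`, and `p` divides
`v / x_i`, which is not in `L`. -/
lemma minimalJanetSet_subset {L U : Set (Fin n →₀ ℕ)} (hL : IsUpperSet L) (hUL : U ⊆ L)
    (hcov : ∀ w ∈ L, ∃ u, JanetDvd U u w) : minimalJanetSet L ⊆ U := by
  intro u hu
  obtain ⟨q, hq⟩ := hcov u hu.1
  by_cases hqu : q = u
  · exact hqu ▸ hq.mem
  obtain ⟨i, hi, hag⟩ := exists_first_ne hqu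
  have hle := hq.le i
  obtain ⟨v, hv, hvu, huv, hn⟩ := hu.2 i (by omega)
  obtain ⟨p, hp⟩ := hcov v hv
  have hpq := hp.eq_of_agree hq.mem fun j hj => (hvu j hj).trans (hag j hj).symm
  have hpi := hq.mult (i := i) (by omega) p hp.mem hpq
  refine (hn (hL (a := p) (fun j => ?_) (hUL hp.mem))).elim
  have := hp.le j
  by_cases hj : j = i
  · subst hj
    simp
    omega
  · simpa [Finsupp.single_eq_of_ne hj] using this

lemma exists_minimal_pommaretDvd {U : Set (Fin n →₀ ℕ)} {w : Fin n →₀ ℕ} (hw : w ∈ U) :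
    ∃ v ∈ U, PommaretDvd v w ∧ ∀ x ∈ U, PommaretDvd x v → x = v := by
  obtain ⟨v, -, ⟨hv, hvw⟩, hmin⟩ := exists_minimal_le_of_wellFoundedLT
    (fun x => x ∈ U ∧ PommaretDvd x w) w ⟨hw, pommaretDvd_refl w⟩
  exact ⟨v, hv, hvw, fun x hx hxv => le_antisymm hxv.le (hmin ⟨hx, hxv.trans hvw⟩ hxv.le)⟩

/-- If a monomial ideal is the Pommaret cone of a finite set, then Janet and Pommaret
multiplicative variables agree for each of its Pommaret autoreduced Janet complete sets. -/
lemma JanetMult.pommaretMult {L P U : Set (Fin n →₀ ℕ)} (hL : IsUpperSet L) (hP : P.Finite)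
    (hPL : P ⊆ L) (hPcov : ∀ w ∈ L, ∃ p ∈ P, PommaretDvd p w) (hUL : U ⊆ L)
    (hUcov : ∀ w ∈ L, ∃ u, JanetDvd U u w) (hU : ∀ u ∈ U, ∀ v ∈ U, PommaretDvd u v → u = v)
    {v : Fin n →₀ ℕ} (hv : v ∈ U) {i : Fin n} (hi : JanetMult U v i) : PommaretMult v i := by
  intro k hk
  by_contra! hik
  obtain ⟨B, hB⟩ := (hP.image fun p => p i).bddAbove
  -- Raising `x_i` beyond every degree in `P` forces the Pommaret divisor `p` of `w` to involve no
  -- variable after `i`, in particular not `x_k`.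
  set w := v + Finsupp.single i (B + 1) with hw
  have hwi : w i = v i + (B + 1) := by simp [hw]
  have hwj : ∀ j, j ≠ i → w j = v j := fun j hj => by simp [hw, Finsupp.single_eq_of_ne hj]
  obtain ⟨p, hp, hpw⟩ := hPcov w (hL le_self_add (hUL hv))
  rw [pommaretDvd_iff] at hpw
  obtain ⟨hle, hmult⟩ := hpw
  have hpi : p i ≤ B := hB ⟨p, hp, rfl⟩
  have hpi' : ∀ j ∈ p.support, j ≤ i := hmult i (by omega)
  have hp0 : ∀ j, i < j → p j = 0 := fun j hj => by
    by_contra h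
    exact absurd (hpi' j (Finsupp.mem_support_iff.2 h)) (not_le.2 hj)
  have hsmall : ∀ j < i, p j < v j → ∀ l ∈ p.support, l ≤ j := fun j hj hlt =>
    hmult j (by rwa [hwj j hj.ne])
  have hlev : ∀ j < i, p j ≤ v j := fun j hj => (hle j).trans (hwj j hj.ne).le
  obtain ⟨q, hq⟩ := hUcov p (hPL hp)
  have hqs : ∀ l ∈ q.support, l ∈ p.support := fun l hl => by
    have := hq.le l
    rw [Finsupp.mem_support_iff] at *
    omega
  -- Once the Janet divisor `q` of `p` is shown to Pommaret divide `v`, autoreducedness gives `q =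
  -- v`, although `x_k` divides `v` and not `p`. The point is that a deficit of `p` against `v` at
  -- some `l < i` kills all variables of `p` after `l`; without one, `q` agrees with `v` as well.
  have hqv : PommaretDvd q v := by
    refine pommaretDvd_iff.2 ⟨fun j => ?_, fun j hj l hl => ?_⟩
    · have hqj := hq.le j
      rcases lt_trichotomy j i with h | rfl | h
      · exact hqj.trans (hlev j h)
      · by_cases hag : ∀ l < j, p l = v l
        · exact hi q hq.mem (hq.eq_of_agree hv hag)
        · push Not at hag
          obtain ⟨l, hl, hne⟩ := hag
          have h1 := hsmall l hl (lt_of_le_of_ne (hlev l hl) hne) j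
          have h2 : p j = 0 := by
            by_contra h
            exact absurd (h1 (Finsupp.mem_support_iff.2 h)) (not_le.2 hl)
          omega
      · have := hp0 j h
        omega
    · have hl' := hqs l hl
      by_contra! hjl
      have hji : j < i := hjl.trans_le (hpi' l hl')
      have hpv : ∀ x ≤ j, p x = v x := fun x hx => by
        by_contra hne
        have := hsmall x (hx.trans_lt hji) (lt_of_le_of_ne (hlev x (hx.trans_lt hji)) hne) l hl'
        exact absurd (this.trans hx) (not_le.2 hjl)
      have hqv := hq.eq_of_agree (i := j) hv fun x hx => hpv x hx.le
      have := hq.mult (i := j) (by rwa [hpv j le_rfl]) v hv fun x hx => (hqv x hx).symm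
      omega
  have hqv' := hU q hq.mem v hv hqv
  have h1 := hq.le k
  rw [hqv', hp0 k hik] at h1
  exact (Finsupp.mem_support_iff.1 hk) (by omega)

/-! ### Reductions and normal forms -/

open MvPolynomial

variable {K : Type*} [Field K] {m : MonomialOrder (Fin n)}
  {D : (Fin n →₀ ℕ) → (Fin n →₀ ℕ) → Prop} {F H : Set (MvPolynomial (Fin n) K)}
  {I : Ideal (MvPolynomial (Fin n) K)}

lemma degree_mem_lmSet {f : MvPolynomial (Fin n) K} (hf : f ∈ F) (h0 : f ≠ 0) :
    m.degree f ∈ lmSet m F :=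
  ⟨f, hf, h0, rfl⟩

lemma lmSet_mono {F G : Set (MvPolynomial (Fin n) K)} (h : F ⊆ G) : lmSet m F ⊆ lmSet m G :=
  fun _ ⟨f, hf, h0, hu⟩ => ⟨f, h hf, h0, hu⟩

lemma lmSet_finite (hF : F.Finite) : (lmSet m F).Finite :=
  (hF.image m.degree).subset fun _ ⟨f, hf, _, hu⟩ => ⟨f, hf, hu⟩

lemma degree_monomial_mul {s : Fin n →₀ ℕ} {f : MvPolynomial (Fin n) K} (hf : f ≠ 0) :
    m.degree (monomial s (1 : K) * f) = s + m.degree f := by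
  classical
  rw [m.degree_mul (by simp) hf, m.degree_monomial, if_neg one_ne_zero]

lemma isUpperSet_lmSet_ideal : IsUpperSet (lmSet m (I : Set (MvPolynomial (Fin n) K))) := by
  rintro u w huw ⟨f, hf, h0, rfl⟩
  refine ⟨monomial (w - m.degree f) 1 * f, I.mul_mem_left _ hf, mul_ne_zero (by simp) h0, ?_⟩
  rw [degree_monomial_mul h0, tsub_add_cancel_of_le huw]

lemma coeff_sub_reduction_self {f : MvPolynomial (Fin n) K} (h0 : f ≠ 0) {t : Fin n →₀ ℕ}
    (hle : m.degree f ≤ t) (g : MvPolynomial (Fin n) K) :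
    (g - monomial (t - m.degree f) (g.coeff t / m.leadingCoeff f) * f).coeff t = 0 := by
  have := coeff_monomial_mul (m.degree f) (t - m.degree f) (g.coeff t / m.leadingCoeff f) f
  rw [tsub_add_cancel_of_le hle] at this
  rw [coeff_sub, this]
  change _ - _ / m.leadingCoeff f * m.leadingCoeff f = 0
  rw [div_mul_cancel₀ _ (m.leadingCoeff_ne_zero_iff.2 h0), sub_self]

lemma coeff_sub_reduction_of_lt {f : MvPolynomial (Fin n) K} {t s : Fin n →₀ ℕ}
    (hle : m.degree f ≤ t) (hs : t ≺[m] s) (c : K) (g : MvPolynomial (Fin n) K) :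
    (g - monomial (t - m.degree f) c * f).coeff s = g.coeff s := by
  have : (monomial (t - m.degree f) c * f).coeff s = 0 := by
    refine m.coeff_eq_zero_of_lt (lt_of_le_of_lt (m.degree_mul_le.trans ?_) hs)
    rw [map_add]
    refine (add_le_add_left (m.degree_monomial_le _) _).trans ?_
    rw [← map_add, tsub_add_cancel_of_le hle]
  rw [coeff_sub, this, sub_zero]

lemma ReducesTo.exists_term (hD : ∀ u t, D u t → u ≤ t) {g g' : MvPolynomial (Fin n) K}
    (h : ReducesTo m D F g g') :
    ∃ t ∈ g.support, (∃ u ∈ lmSet m F, D u t) ∧ g'.coeff t = 0 ∧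
      ∀ s, t ≺[m] s → g'.coeff s = g.coeff s := by
  obtain ⟨f, hf, h0, t, ht, hdvd, rfl⟩ := h
  have hle := hD _ _ hdvd
  exact ⟨t, ht, ⟨_, degree_mem_lmSet hf h0, hdvd⟩, coeff_sub_reduction_self h0 hle g,
    fun s hs => coeff_sub_reduction_of_lt hle hs _ g⟩

lemma ReducesTo.sub_mem {g g' : MvPolynomial (Fin n) K} (hFI : F ⊆ I)
    (h : ReducesTo m D F g g') : g - g' ∈ I := by
  obtain ⟨f, hf, h0, t, ht, hdvd, rfl⟩ := h
  rw [sub_sub_cancel]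
  exact I.mul_mem_left _ (hFI hf)

lemma sub_mem_of_reflTransGen {g g' : MvPolynomial (Fin n) K} (hFI : F ⊆ I)
    (h : Relation.ReflTransGen (ReducesTo m D F) g g') : g - g' ∈ I := by
  induction h with
  | refl => simp
  | tail _ h ih => simpa using I.add_mem ih (h.sub_mem hFI)

lemma ReducesTo.mono {D' : (Fin n →₀ ℕ) → (Fin n →₀ ℕ) → Prop} (hDD : ∀ u ∈ lmSet m F, ∀ t, D u t → D' u t)
    {g g' : MvPolynomial (Fin n) K} (h : ReducesTo m D F g g') : ReducesTo m D' F g g' := by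
  obtain ⟨f, hf, h0, t, ht, hdvd, h⟩ := h
  exact ⟨f, hf, h0, t, ht, hDD _ (degree_mem_lmSet hf h0) _ hdvd, h⟩

/-- Always reducing the largest reducible term makes that term strictly decrease, and the ordering
is well-founded. -/
lemma exists_isNormalForm (hD : ∀ u t, D u t → u ≤ t) (F : Set (MvPolynomial (Fin n) K))
    (g : MvPolynomial (Fin n) K) : ∃ h, IsNormalForm m D F g h := by
  classical
  have key : ∀ (a : m.syn) (g : MvPolynomial (Fin n) K),
      (∀ t ∈ g.support, (∃ u ∈ lmSet m F, D u t) → m.toSyn t ≤ a) →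
      ∃ h, IsNormalForm m D F g h := by
    intro a
    induction a using WellFoundedLT.induction with
    | ind a ih =>
      intro g hg
      let T := g.support.filter fun t => ∃ u ∈ lmSet m F, D u t
      by_cases hT : T.Nonempty
      · obtain ⟨t, htT, hmax⟩ := T.exists_max_image m.toSyn hT
        obtain ⟨ht, u, ⟨f, hf, h0, rfl⟩, hdvd⟩ := Finset.mem_filter.1 htT
        set r := monomial (t - m.degree f) (g.coeff t / m.leadingCoeff f) * f
        have hle := hD _ _ hdvd
        have hred : ReducesTo m D F g (g - r) := ⟨f, hf, h0, t, ht, hdvd, rfl⟩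
        have hrt : (g - r).coeff t = 0 := coeff_sub_reduction_self h0 hle g
        have hlt : ∀ s ∈ (g - r).support, (∃ u ∈ lmSet m F, D u s) → s ≺[m] t := by
          intro s hs hu
          by_contra! hts
          have hne : s ≠ t := by
            rintro rfl
            exact mem_support_iff.1 hs hrt
          have hts' : t ≺[m] s := lt_of_le_of_ne hts fun h => hne (m.toSyn.injective h).symm
          have : s ∈ g.support := by
            rw [mem_support_iff, coeff_sub_reduction_of_lt hle hts'] at hs
            exact mem_support_iff.2 hs
          exact absurd (hmax s (Finset.mem_filter.2 ⟨this, hu⟩)) (not_le.2 hts')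
        let T' := (g - r).support.filter fun t => ∃ u ∈ lmSet m F, D u t
        by_cases hT' : T'.Nonempty
        · obtain ⟨s, hsT, hsmax⟩ := T'.exists_max_image m.toSyn hT'
          obtain ⟨hs, hu⟩ := Finset.mem_filter.1 hsT
          obtain ⟨h, h1, h2⟩ := ih (m.toSyn s)
            ((hlt s hs hu).trans_le (hg t ht ⟨_, degree_mem_lmSet hf h0, hdvd⟩)) (g - r)
            fun t ht hu => hsmax t (Finset.mem_filter.2 ⟨ht, hu⟩)
          exact ⟨h, .head hred h1, h2⟩
        · refine ⟨g - r, .single hred, fun t ht u hu hd => hT' ⟨t, ?_⟩⟩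
          exact Finset.mem_filter.2 ⟨ht, u, hu, hd⟩
      · refine ⟨g, .refl, fun t ht u hu hd => hT ⟨t, ?_⟩⟩
        exact Finset.mem_filter.2 ⟨ht, u, hu, hd⟩
  exact key (m.toSyn (m.degree g)) g fun t ht _ => m.le_degree ht

lemma IsNormalForm.eq_zero (hFI : F ⊆ I)
    (hcov : ∀ w ∈ lmSet m (I : Set (MvPolynomial (Fin n) K)), ∃ u ∈ lmSet m F, D u w)
    {g h : MvPolynomial (Fin n) K} (hg : g ∈ I) (hh : IsNormalForm m D F g h) : h = 0 := by
  by_contra h0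
  have hI : h ∈ I := by simpa using I.sub_mem hg (sub_mem_of_reflTransGen hFI hh.1)
  obtain ⟨u, hu, hd⟩ := hcov _ (degree_mem_lmSet hI h0)
  exact hh.2 _ (m.degree_mem_support h0) u hu hd

/-- A nonzero linear combination of polynomials with distinct leading monomials has one of these
leading monomials. -/
lemma exists_degree_eq_of_mem_span {S : Set (MvPolynomial (Fin n) K)} (hS : ∀ p ∈ S, p ≠ 0)
    (hinj : Set.InjOn m.degree S) {g : MvPolynomial (Fin n) K} (hg : g ∈ Submodule.span K S)
    (h0 : g ≠ 0) : ∃ p ∈ S, m.degree p = m.degree g := by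
  obtain ⟨c, hc, rfl⟩ := Submodule.mem_span_set.1 hg
  have hne : c.support.Nonempty := by
    rw [Finset.nonempty_iff_ne_empty]
    intro h
    exact h0 (by simp [Finsupp.sum, h])
  obtain ⟨p, hp, hmax⟩ := c.support.exists_max_image (fun p => m.toSyn (m.degree p)) hne
  refine ⟨p, hc hp, m.toSyn.injective (le_antisymm (m.le_degree ?_) (m.degree_le_iff.2 ?_))⟩
  · rw [mem_support_iff, Finsupp.sum, coeff_sum, Finset.sum_eq_single p]
    · rw [coeff_smul]
      exact mul_ne_zero (Finsupp.mem_support_iff.1 hp)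
        (m.coeff_degree_ne_zero_iff.2 (hS p (hc hp)))
    · intro q hq hqp
      rw [coeff_smul, m.coeff_eq_zero_of_lt, smul_zero]
      exact lt_of_le_of_ne (hmax q hq)
        fun h => hqp (hinj (hc hq) (hc hp) (m.toSyn.injective h))
    · exact fun h => (h hp).elim
  · intro t ht
    by_contra! hlt
    refine mem_support_iff.1 ht ?_
    rw [Finsupp.sum, coeff_sum]
    refine Finset.sum_eq_zero fun q hq => ?_
    rw [coeff_smul, m.coeff_eq_zero_of_lt ((hmax q hq).trans_lt hlt), smul_zero]

/-! ### Leading monomials of ideals with a Janet basis -/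

/-- The span of the `D`-multiplicative multiples of elements of `F` with leading monomial at
most `w`. -/
noncomputable def involutiveSpan (m : MonomialOrder (Fin n)) (D : (Fin n →₀ ℕ) → (Fin n →₀ ℕ) → Prop)
    (F : Set (MvPolynomial (Fin n) K)) (w : Fin n →₀ ℕ) :
    Submodule K (MvPolynomial (Fin n) K) :=
  Submodule.span K {p | ∃ f ∈ F, ∃ s, D (m.degree f) (s + m.degree f) ∧
    s + m.degree f ≼[m] w ∧ p = monomial s 1 * f}

lemma involutiveSpan_mono {v w : Fin n →₀ ℕ} (h : v ≼[m] w) :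
    involutiveSpan m D F v ≤ involutiveSpan m D F w :=
  Submodule.span_mono fun _ ⟨f, hf, s, hd, hle, hp⟩ => ⟨f, hf, s, hd, hle.trans h, hp⟩

/-- Each step subtracts a multiplicative multiple whose leading monomial is the cancelled term, and
no such term exceeds the leading monomial of `g`. -/
lemma mem_involutiveSpan_of_reduces (hD : ∀ u t, D u t → u ≤ t) {w : Fin n →₀ ℕ}
    {g : MvPolynomial (Fin n) K} (h : Relation.ReflTransGen (ReducesTo m D F) g 0)
    (hg : m.degree g ≼[m] w) : g ∈ involutiveSpan m D F w := by
  induction h using Relation.ReflTransGen.head_induction_on with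
  | refl => exact zero_mem _
  | head hstep _ ih =>
    rename_i a b _
    obtain ⟨t, ht, -, ht0, hts⟩ := hstep.exists_term hD
    have htw : t ≼[m] w := (m.le_degree ht).trans hg
    have hb : m.degree b ≼[m] w := by
      refine m.degree_le_iff.2 fun s hs => ?_
      by_contra! hlt
      refine mem_support_iff.1 hs ?_
      rw [hts s (htw.trans_lt hlt), m.coeff_eq_zero_of_lt (hg.trans_lt hlt)]
    have hbV := ih hb
    obtain ⟨f, hf, h0, t, ht, hd, rfl⟩ := hstep
    have htw : t ≼[m] w := (m.le_degree ht).trans hg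
    have hle := hD _ _ hd
    have hr : monomial (t - m.degree f) (a.coeff t / m.leadingCoeff f) * f =
        (a.coeff t / m.leadingCoeff f) • (monomial (t - m.degree f) 1 * f) := by
      rw [← smul_mul_assoc, smul_monomial, smul_eq_mul, mul_one]
    rw [← sub_add_cancel a (monomial (t - m.degree f) (a.coeff t / m.leadingCoeff f) * f)]
    refine add_mem hbV ?_
    rw [hr]
    refine Submodule.smul_mem _ _ (Submodule.subset_span ⟨f, hf, t - m.degree f, ?_, ?_, rfl⟩)
    · rwa [tsub_add_cancel_of_le hle]
    · rwa [tsub_add_cancel_of_le hle]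

/-- Replace a nonmultiplicative `f * X i` by a combination of multiplicative multiples. Those
contributing below `w` are handled by the outer induction; those contributing at `w` come from
lexicographically larger leading monomials. -/
lemma monomial_mul_mem_involutiveSpan (hfin : F.Finite) (hF0 : ∀ f ∈ F, f ≠ 0)
    (hloc : ∀ f ∈ F, ∀ i : Fin n, ¬ JanetMult (lmSet m F) (m.degree f) i →
      IsJanetNF m F (f * X i) 0) (w : Fin n →₀ ℕ) {f : MvPolynomial (Fin n) K} (hf : f ∈ F)
    {s : Fin n →₀ ℕ} (hs : s + m.degree f = w) :
    monomial s 1 * f ∈ involutiveSpan m (JanetDvd (lmSet m F)) F w := by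
  have hwf : WellFounded fun a b : Fin n →₀ ℕ => a ≺[m] b :=
    InvImage.wf m.toSyn wellFounded_lt
  revert f s
  induction w using hwf.induction with
  | _ w ihw =>
  -- The inner induction descends along increasing lexicographic order of leading monomials,
  -- unrelated to `m`; it is well-founded because `F` is finite.
  let r : MvPolynomial (Fin n) K → MvPolynomial (Fin n) K → Prop :=
    fun a b => toLex (m.degree b) < toLex (m.degree a)
  have : IsStrictOrder _ r :=
    { irrefl := fun a => lt_irrefl _
      trans := fun a b c h1 h2 => lt_trans h2 h1 }
  intro f hf
  refine (hfin.wellFoundedOn (r := r)).induction (P := fun f => ∀ {s : Fin n →₀ ℕ},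
    s + m.degree f = w → monomial s 1 * f ∈ involutiveSpan m (JanetDvd (lmSet m F)) F w) hf ?_
  clear! f
  intro f hf ihf s hs
  by_cases hd : JanetDvd (lmSet m F) (m.degree f) (s + m.degree f)
  · exact Submodule.subset_span ⟨f, hf, s, hd, by rw [hs], rfl⟩
  obtain ⟨i, hi, hmult⟩ : ∃ i ∈ s.support, ¬ JanetMult (lmSet m F) (m.degree f) i := by
    by_contra! hc
    exact hd ⟨degree_mem_lmSet hf (hF0 f hf), s, add_comm _ _, hc⟩
  have hsi : Finsupp.single i 1 ≤ s := by
    rw [Finsupp.single_le_iff]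
    exact Nat.one_le_iff_ne_zero.2 (Finsupp.mem_support_iff.1 hi)
  have hX := mem_involutiveSpan_of_reduces (w := m.degree f + Finsupp.single i 1)
    (fun u t h => JanetDvd.le h) (hloc f hf i hmult).1
    (by rw [m.degree_mul (hF0 f hf) (by simp), m.degree_X])
  have hmul : monomial s (1 : K) * f = monomial (s - Finsupp.single i 1) 1 * (f * X i) := by
    rw [mul_comm f, ← mul_assoc, X, monomial_mul, tsub_add_cancel_of_le hsi, mul_one]
  have hsw : s - Finsupp.single i 1 + (m.degree f + Finsupp.single i 1) = w := by
    rw [add_comm (m.degree f), ← add_assoc, tsub_add_cancel_of_le hsi, hs]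
  rw [hmul]
  generalize f * X i = g at hX
  refine Submodule.span_induction (p := fun g _ => monomial (s - Finsupp.single i 1) 1 * g ∈
    involutiveSpan m (JanetDvd (lmSet m F)) F w) ?_ ?_ ?_ ?_ hX
  · rintro _ ⟨f', hf', s', hd', hle, rfl⟩
    rw [← mul_assoc, monomial_mul, mul_one]
    rcases hle.lt_or_eq with hlt | heq
    · have hlt' : s - Finsupp.single i 1 + s' + m.degree f' ≺[m] w := by
        rw [← hsw, add_assoc, map_add, map_add m.toSyn (s - Finsupp.single i 1)]
        exact add_lt_add_right hlt _
      exact involutiveSpan_mono hlt'.le (ihw _ hlt' hf' rfl)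
    · have heq' := m.toSyn.injective heq
      refine ihf f' hf' ?_ (by rw [add_assoc, heq', hsw])
      rw [heq'] at hd'
      exact hd'.toLex_lt (degree_mem_lmSet hf (hF0 f hf)) hmult
  · simp
  · intro x y _ _ hx hy
    rw [mul_add]
    exact add_mem hx hy
  · intro c x _ hx
    rw [mul_smul_comm]
    exact Submodule.smul_mem _ _ hx

/-- The Janet cones of a set satisfying the local criterion for Janet bases cover the leading
monomials of the ideal it generates. -/
lemma exists_janetDvd_of_local (hfin : F.Finite) (hF0 : ∀ f ∈ F, f ≠ 0)
    (hinj : Set.InjOn m.degree F)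
    (hloc : ∀ f ∈ F, ∀ i : Fin n, ¬ JanetMult (lmSet m F) (m.degree f) i →
      IsJanetNF m F (f * X i) 0) {w : Fin n →₀ ℕ}
    (hw : w ∈ lmSet m (Ideal.span F : Set (MvPolynomial (Fin n) K))) :
    ∃ u, JanetDvd (lmSet m F) u w := by
  obtain ⟨g, hg, h0, rfl⟩ := hw
  let S : Set (MvPolynomial (Fin n) K) := {p | ∃ f ∈ F, ∃ s,
    JanetDvd (lmSet m F) (m.degree f) (s + m.degree f) ∧ p = monomial s 1 * f}
  have hgS : g ∈ Submodule.span K S := by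
    obtain ⟨c, hc, rfl⟩ := Submodule.mem_span_set.1 hg
    refine sum_mem fun f hf => ?_
    change c f • f ∈ _
    rw [smul_eq_mul, (c f).as_sum, Finset.sum_mul]
    refine sum_mem fun s _ => ?_
    have : monomial s (coeff s (c f)) * f = coeff s (c f) • (monomial s 1 * f) := by
      rw [← smul_mul_assoc, smul_monomial, smul_eq_mul, mul_one]
    rw [this]
    refine Submodule.smul_mem _ _ (Submodule.span_mono ?_
      (monomial_mul_mem_involutiveSpan hfin hF0 hloc _ (hc hf) rfl))
    rintro _ ⟨f, hf, s, hd, -, rfl⟩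
    exact ⟨f, hf, s, hd, rfl⟩
  have hS0 : ∀ p ∈ S, p ≠ 0 := by
    rintro _ ⟨f, hf, s, -, rfl⟩
    exact mul_ne_zero (by simp) (hF0 f hf)
  -- Uniqueness of Janet divisors: disjoint cones give the multiplicative multiples distinct leading
  -- monomials.
  have hSinj : Set.InjOn m.degree S := by
    rintro _ ⟨f, hf, s, hd, rfl⟩ _ ⟨f', hf', s', hd', rfl⟩ heq
    rw [degree_monomial_mul (hF0 f hf), degree_monomial_mul (hF0 f' hf')] at heq
    rw [heq] at hd
    obtain rfl := hinj hf hf' (hd.unique hd')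
    rw [add_left_inj] at heq
    rw [heq]
  obtain ⟨p, ⟨f, hf, s, hd, rfl⟩, hp⟩ := exists_degree_eq_of_mem_span hS0 hSinj hgS h0
  rw [degree_monomial_mul (hF0 f hf)] at hp
  exact ⟨_, hp ▸ hd⟩

/-- A finite set of nonzero elements of `I` with distinct leading monomials whose Janet cones
cover the leading monomials of `I`. -/
structure IsJanetSpanning (m : MonomialOrder (Fin n)) (I : Ideal (MvPolynomial (Fin n) K))
    (F : Set (MvPolynomial (Fin n) K)) : Prop where
  finite : F.Finite
  ne_zero : ∀ f ∈ F, f ≠ 0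
  subset : F ⊆ I
  injOn : Set.InjOn m.degree F
  cover : ∀ w ∈ lmSet m (I : Set (MvPolynomial (Fin n) K)), ∃ u, JanetDvd (lmSet m F) u w

lemma IsJanetBasis.isJanetSpanning (h : IsJanetBasis m I F) : IsJanetSpanning m I F where
  finite := h.1.1
  ne_zero := h.1.2.1
  subset := h.2.1 ▸ Ideal.subset_span
  injOn := h.1.2.2.1
  cover w hw := by
    refine exists_janetDvd_of_local h.1.1 h.1.2.1 h.1.2.2.1 h.2.2 ?_
    rwa [h.2.1]

namespace IsJanetSpanning

lemma lmSet_subset (hF : IsJanetSpanning m I F) :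
    lmSet m F ⊆ lmSet m (I : Set (MvPolynomial (Fin n) K)) :=
  lmSet_mono hF.subset

lemma nf_eq_zero (hF : IsJanetSpanning m I F) {g h : MvPolynomial (Fin n) K} (hg : g ∈ I)
    (hh : IsJanetNF m F g h) : h = 0 := by
  refine IsNormalForm.eq_zero hF.subset (fun w hw => ?_) hg hh
  obtain ⟨u, hu⟩ := hF.cover w hw
  exact ⟨u, hu.mem, hu⟩

lemma isJanetNF_zero (hF : IsJanetSpanning m I F) {g : MvPolynomial (Fin n) K} (hg : g ∈ I) :
    IsJanetNF m F g 0 := by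
  obtain ⟨h, hh⟩ := exists_isNormalForm (m := m) (D := JanetDvd (lmSet m F))
    (fun _ _ h => h.le) F g
  have := hF.nf_eq_zero hg hh
  rwa [this] at hh

lemma isJanetBasis (hF : IsJanetSpanning m I F) (ha : IsJanetAutoreduced m F) :
    IsJanetBasis m I F := by
  refine ⟨ha, le_antisymm (Ideal.span_le.2 hF.subset) fun g hg => ?_, fun f hf i _ =>
    hF.isJanetNF_zero (I.mul_mem_right _ (hF.subset hf))⟩
  simpa using sub_mem_of_reflTransGen (I := Ideal.span F) Ideal.subset_span
    (hF.isJanetNF_zero hg).1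

end IsJanetSpanning

/-! ### The repeat-loop -/

/-- The elements of `F` whose leading monomial has no proper Pommaret divisor among the leading
monomials of `F`. -/
def pommaretMinimal (m : MonomialOrder (Fin n)) (F : Set (MvPolynomial (Fin n) K)) :
    Set (MvPolynomial (Fin n) K) :=
  {f | f ∈ F ∧ ∀ u ∈ lmSet m F, PommaretDvd u (m.degree f) → u = m.degree f}

lemma pommaretMinimal_subset : pommaretMinimal m F ⊆ F := fun _ h => h.1

lemma exists_pommaretDvd_pommaretMinimal {u : Fin n →₀ ℕ} (hu : u ∈ lmSet m F) :
    ∃ v ∈ lmSet m (pommaretMinimal m F), PommaretDvd v u := by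
  obtain ⟨_, ⟨f, hf, h0, rfl⟩, hvu, hmin⟩ := exists_minimal_pommaretDvd hu
  exact ⟨_, ⟨f, ⟨hf, hmin⟩, h0, rfl⟩, hvu⟩

lemma eq_of_pommaretDvd_pommaretMinimal {u v : Fin n →₀ ℕ}
    (hu : u ∈ lmSet m (pommaretMinimal m F)) (hv : v ∈ lmSet m (pommaretMinimal m F))
    (huv : PommaretDvd u v) : u = v := by
  obtain ⟨f, hf, h0, rfl⟩ := hv
  exact hf.2 u (lmSet_mono pommaretMinimal_subset hu) huv

lemma pommaretMinimal_pommaretMinimal :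
    pommaretMinimal m (pommaretMinimal m F) = pommaretMinimal m F :=
  pommaretMinimal_subset.antisymm fun _ hf =>
    ⟨hf, fun u hu h => hf.2 u (lmSet_mono pommaretMinimal_subset hu) h⟩

/-- A discarded Janet divisor is replaced by a Pommaret-minimal Pommaret divisor of it, whose Janet
cone in the smaller set takes over. -/
lemma IsJanetSpanning.pommaretMinimal (hF : IsJanetSpanning m I F) :
    IsJanetSpanning m I (pommaretMinimal m F) where
  finite := hF.finite.subset pommaretMinimal_subset
  ne_zero f hf := hF.ne_zero f hf.1
  subset := pommaretMinimal_subset.trans hF.subset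
  injOn := hF.injOn.mono pommaretMinimal_subset
  cover w hw := by
    obtain ⟨u, hu⟩ := hF.cover w hw
    obtain ⟨v, hv, hvu⟩ := exists_pommaretDvd_pommaretMinimal hu.mem
    exact ⟨v, hu.of_pommaretDvd (lmSet_mono pommaretMinimal_subset)
      (fun _ hu _ hv => eq_of_pommaretDvd_pommaretMinimal hu hv) hv hvu⟩

lemma exists_whileLoop (s : Set (MvPolynomial (Fin n) K) × Set (MvPolynomial (Fin n) K))
    (hs : s.2.Finite) : ∃ s', WhileLoop m s s' := by
  induction hk : s.2.ncard using Nat.strong_induction_on generalizing s with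
  | _ k ih =>
    by_cases h : ∃ s', WhileStep m s s'
    · obtain ⟨s', h, hh, hc, rfl⟩ := h
      obtain ⟨s', hs'⟩ := ih _ (hk ▸ Set.ncard_sdiff_singleton_lt_of_mem hh hs)
        (s.1 ∪ {h}, s.2 \ {h}) hs.sdiff rfl
      exact ⟨s', hs'.1.head ⟨h, hh, hc, rfl⟩, hs'.2⟩
    · push Not at h
      exact ⟨s, .refl, h⟩

/-- The outcome is independent of choices: Pommaret-minimal elements are never moved, and a
surviving non-minimal element would have a surviving minimal divisor, allowing another step. -/
lemma WhileLoop.eq_pommaretMinimal (hinj : Set.InjOn m.degree F)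
    {s : Set (MvPolynomial (Fin n) K) × Set (MvPolynomial (Fin n) K)}
    (h : WhileLoop m (∅, F) s) : s.1 ⊆ F ∧ s.2 = pommaretMinimal m F := by
  have hinv : s.1 ⊆ F ∧ s.2 ⊆ F ∧ pommaretMinimal m F ⊆ s.2 := by
    refine Relation.ReflTransGen.trans_induction_on (motive := fun {a b} _ =>
      a.1 ⊆ F ∧ a.2 ⊆ F ∧ pommaretMinimal m F ⊆ a.2 →
      b.1 ⊆ F ∧ b.2 ⊆ F ∧ pommaretMinimal m F ⊆ b.2) h.1 (fun _ => id) ?_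
      (fun _ _ h1 h2 => h2 ∘ h1) ⟨Set.empty_subset _, subset_rfl, pommaretMinimal_subset⟩
    rintro ⟨G, H⟩ _ ⟨g, hg, ⟨u, ⟨f, hf, h0, rfl⟩, hd⟩, rfl⟩ ⟨h1, h2, h3⟩
    refine ⟨Set.union_subset h1 (Set.singleton_subset_iff.2 (h2 hg)),
      Set.sdiff_subset.trans h2, fun x hx => ⟨h3 hx, ?_⟩⟩
    rintro rfl
    exact hf.2 (hinj (h2 hf.1) (h2 hg) (hx.2 _ (degree_mem_lmSet (h2 hf.1) h0) hd))
  refine ⟨hinv.1, subset_antisymm (fun g hg => ⟨hinv.2.1 hg, fun u hu hd => ?_⟩) hinv.2.2⟩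
  obtain ⟨_, ⟨f, hf, h0, rfl⟩, hvu⟩ := exists_pommaretDvd_pommaretMinimal hu
  by_cases hfg : f = g
  · subst hfg
    exact hd.antisymm hvu
  · exact (h.2 _ ⟨g, hg, ⟨_, ⟨f, ⟨hinv.2.2 hf, hfg⟩, h0, rfl⟩, hvu.trans hd⟩, rfl⟩).elim

lemma IsJanetSpanning.forLoop (hH : IsJanetSpanning m I H) {G : Set (MvPolynomial (Fin n) K)}
    (hG : G.Finite) (hGI : G ⊆ I) : Relation.ReflTransGen (ForStep m) (G, H) (∅, H) := by
  induction G, hG using Set.Finite.induction_on with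
  | empty => exact .refl
  | @insert g G hg _ ih =>
    rw [Set.insert_subset_iff] at hGI
    refine .head ⟨g, Set.mem_insert _ _, 0, hH.isJanetNF_zero hGI.1, ?_⟩ (ih hGI.2)
    simp [hg]

lemma IsJanetSpanning.forLoop_eq (hH : IsJanetSpanning m I H)
    {s s' : Set (MvPolynomial (Fin n) K) × Set (MvPolynomial (Fin n) K)}
    (h : Relation.ReflTransGen (ForStep m) s s') (hs1 : s.1 ⊆ I) (hs2 : s.2 = H) :
    s'.1 ⊆ I ∧ s'.2 = H := by
  induction h with
  | refl => exact ⟨hs1, hs2⟩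
  | tail _ hstep ih =>
    obtain ⟨g, hg, f, hf, rfl⟩ := hstep
    obtain ⟨h1, rfl⟩ := ih
    have := hH.nf_eq_zero (h1 hg) hf
    exact ⟨Set.sdiff_subset.trans h1, by simp [this]⟩

lemma IsJanetSpanning.repeatBody_iff (hF : IsJanetSpanning m I F) :
    RepeatBody m F H ↔ H = Involutive.pommaretMinimal m F := by
  constructor
  · rintro ⟨s, hw, hf⟩
    obtain ⟨h1, h2⟩ := hw.eq_pommaretMinimal hF.injOn
    exact (hF.pommaretMinimal.forLoop_eq hf (h1.trans hF.subset) h2).2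
  · rintro rfl
    obtain ⟨⟨G, H⟩, hs⟩ := exists_whileLoop (m := m) (∅, F) hF.finite
    obtain ⟨h1, h2⟩ := hs.eq_pommaretMinimal hF.injOn
    subst h2
    exact ⟨_, hs, hF.pommaretMinimal.forLoop (hF.finite.subset h1) (h1.trans hF.subset)⟩

lemma IsJanetSpanning.repeatLoop_iff (hF : IsJanetSpanning m I F) :
    RepeatLoop m F H ↔ H = Involutive.pommaretMinimal m F := by
  constructor
  · intro h
    induction h with
    | done h => exact hF.repeatBody_iff.1 h
    | again h _ _ ih =>
      obtain rfl := hF.repeatBody_iff.1 h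
      rw [ih hF.pommaretMinimal, pommaretMinimal_pommaretMinimal]
  · rintro rfl
    have hdone : RepeatLoop m (Involutive.pommaretMinimal m F) (Involutive.pommaretMinimal m F) :=
      .done (hF.pommaretMinimal.repeatBody_iff.2 pommaretMinimal_pommaretMinimal.symm)
    -- The second pass changes nothing; it is needed only if the first one did.
    by_cases h : Involutive.pommaretMinimal m F = F
    · rwa [h] at hdone ⊢
    · exact .again (hF.repeatBody_iff.2 rfl) h hdone

/-! ### Janet autoreduction -/

namespace IsJanetSpanning

lemma notMem_diff (hH : IsJanetSpanning m I H) {h g : MvPolynomial (Fin n) K} (hh : h ∈ H)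
    (hg : m.degree g = m.degree h) : g ∉ H \ {h} :=
  fun hgH => hgH.2 (hH.injOn hgH.1 hh hg)

lemma lmSet_replace (hH : IsJanetSpanning m I H) {h g : MvPolynomial (Fin n) K} (hh : h ∈ H)
    (hg0 : g ≠ 0) (hg : m.degree g = m.degree h) :
    lmSet m ((H \ {h}) ∪ {g}) = lmSet m H := by
  ext u
  constructor
  · rintro ⟨f, hf | rfl, h0, rfl⟩
    · exact degree_mem_lmSet hf.1 h0
    · rw [hg]
      exact degree_mem_lmSet hh (hH.ne_zero h hh)
  · rintro ⟨f, hf, h0, rfl⟩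
    by_cases hfh : f = h
    · subst hfh
      exact ⟨g, Or.inr rfl, hg0, hg⟩
    · exact ⟨f, Or.inl ⟨hf, hfh⟩, h0, rfl⟩

lemma replace (hH : IsJanetSpanning m I H) {h g : MvPolynomial (Fin n) K} (hh : h ∈ H)
    (hg0 : g ≠ 0) (hgI : g ∈ I) (hg : m.degree g = m.degree h) :
    IsJanetSpanning m I ((H \ {h}) ∪ {g}) where
  finite := hH.finite.sdiff.union (Set.finite_singleton g)
  ne_zero := by
    rintro f (hf | rfl)
    exacts [hH.ne_zero f hf.1, hg0]
  subset := Set.union_subset (Set.sdiff_subset.trans hH.subset) (Set.singleton_subset_iff.2 hgI)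
  injOn := by
    rintro f (hf | rfl) f' (hf' | rfl) heq
    · exact hH.injOn hf.1 hf'.1 heq
    · exact (hf.2 (hH.injOn hf.1 hh (heq.trans hg))).elim
    · exact (hf'.2 (hH.injOn hf'.1 hh (heq.symm.trans hg))).elim
    · rfl
  cover := by
    rw [hH.lmSet_replace hh hg0 hg]
    exact hH.cover

/-- The leading monomial of `h` is its own unique Janet divisor, so the other elements reduce only
lower terms. Thus the leading monomials, and with them the Janet separation, stay fixed during
autoreduction. -/
lemma tail_reduces (hH : IsJanetSpanning m I H) {h g g' : MvPolynomial (Fin n) K} (hh : h ∈ H)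
    (hg : m.degree g = m.degree h) (hg0 : g ≠ 0)
    (hred : ReducesTo m (JanetDvd (lmSet m H)) (H \ {h}) g g') :
    m.degree g' = m.degree h ∧ g' ≠ 0 ∧ m.leadingCoeff g' = m.leadingCoeff g := by
  obtain ⟨t, ht, ⟨_, ⟨f, hf, h0, rfl⟩, hd⟩, hgt, hgs⟩ := hred.exists_term fun _ _ h => h.le
  have hne : t ≠ m.degree g := by
    rintro rfl
    rw [hg] at hd
    exact hf.2 (hH.injOn hf.1 hh
      (hd.unique (janetDvd_refl (degree_mem_lmSet hh (hH.ne_zero h hh)))))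
  have hlt : t ≺[m] m.degree g :=
    lt_of_le_of_ne (m.le_degree ht) fun h => hne (m.toSyn.injective h)
  have hc : g'.coeff (m.degree g) = m.leadingCoeff g := hgs _ hlt
  have hmem : m.degree g ∈ g'.support := by
    rw [mem_support_iff, hc]
    exact m.leadingCoeff_ne_zero_iff.2 hg0
  have hdeg : m.degree g' = m.degree g := by
    refine m.toSyn.injective (le_antisymm (m.degree_le_iff.2 fun s hs => ?_) (m.le_degree hmem))
    by_contra! hs'
    refine mem_support_iff.1 hs ?_
    rw [hgs s (hlt.trans hs'), m.coeff_eq_zero_of_lt hs']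
  refine ⟨hdeg.trans hg, ?_, ?_⟩
  · rintro rfl
    simp at hmem
  · rw [MonomialOrder.leadingCoeff, hdeg, hc]

lemma step (hH : IsJanetSpanning m I H) {H' : Set (MvPolynomial (Fin n) K)}
    (h : JanetAutoreduceStep m H H') :
    IsJanetSpanning m I H' ∧ lmSet m H' = lmSet m H ∧
      ∀ g ∈ H', ∃ f ∈ H, m.degree g = m.degree f ∧ m.leadingCoeff g = m.leadingCoeff f := by
  obtain ⟨h, hh, h', hred, rfl⟩ := h
  obtain ⟨hdeg, h0, hc⟩ := hH.tail_reduces hh rfl (hH.ne_zero h hh) hred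
  have hI : h' ∈ I := by
    simpa using I.sub_mem (hH.subset hh) (hred.sub_mem (Set.sdiff_subset.trans hH.subset))
  have : ({h'} : Set (MvPolynomial (Fin n) K)) \ {0} = {h'} := by simpa using h0
  rw [this]
  refine ⟨hH.replace hh h0 hI hdeg, hH.lmSet_replace hh h0 hdeg, ?_⟩
  rintro g (hg | rfl)
  · exact ⟨g, hg.1, rfl, rfl⟩
  · exact ⟨h, hh, hdeg, hc⟩

lemma steps (hH : IsJanetSpanning m I H) {H' : Set (MvPolynomial (Fin n) K)}
    (h : Relation.ReflTransGen (JanetAutoreduceStep m) H H') :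
    IsJanetSpanning m I H' ∧ lmSet m H' = lmSet m H ∧
      ∀ g ∈ H', ∃ f ∈ H, m.degree g = m.degree f ∧ m.leadingCoeff g = m.leadingCoeff f := by
  induction h with
  | refl => exact ⟨hH, rfl, fun g hg => ⟨g, hg, rfl, rfl⟩⟩
  | tail _ hstep ih =>
    obtain ⟨h1, h2, h3⟩ := ih
    obtain ⟨h4, h5, h6⟩ := h1.step hstep
    refine ⟨h4, h5.trans h2, fun g hg => ?_⟩
    obtain ⟨f, hf, hd, hc⟩ := h6 g hg
    obtain ⟨f', hf', hd', hc'⟩ := h3 f hf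
    exact ⟨f', hf', hd.trans hd', hc.trans hc'⟩

lemma isJanetBasis_of_isJanetAutoreduction (hH : IsJanetSpanning m I H)
    {G : Set (MvPolynomial (Fin n) K)} (h : IsJanetAutoreduction m H G) :
    IsJanetBasis m I G ∧ lmSet m G = lmSet m H :=
  ⟨(hH.steps h.1).1.isJanetBasis h.2, (hH.steps h.1).2.1⟩

/-- Elements of the two outputs with equal leading monomials have equal leading coefficients. If
their difference were nonzero, its leading monomial would be a term of one of them with a Janet
divisor; autoreducedness makes that divisor the common leading monomial, which is too large. -/
lemma subset_of_isJanetAutoreduction (hH : IsJanetSpanning m I H)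
    {G G' : Set (MvPolynomial (Fin n) K)} (hG : IsJanetAutoreduction m H G)
    (hG' : IsJanetAutoreduction m H G') : G ⊆ G' := by
  intro g hg
  obtain ⟨h1, h2, h3⟩ := hH.steps hG.1
  obtain ⟨h1', h2', h3'⟩ := hH.steps hG'.1
  have hlm : lmSet m G = lmSet m G' := h2.trans h2'.symm
  obtain ⟨g', hg', h0', hd⟩ : m.degree g ∈ lmSet m G' :=
    hlm ▸ degree_mem_lmSet hg (h1.ne_zero g hg)
  have hc : m.leadingCoeff g = m.leadingCoeff g' := by
    obtain ⟨f, hf, hfd, hfc⟩ := h3 g hg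
    obtain ⟨f', hf', hfd', hfc'⟩ := h3' g' hg'
    have : f = f' := hH.injOn hf hf' (by rw [← hfd, ← hfd', hd])
    rw [hfc, hfc', this]
  suffices g - g' = 0 by
    rwa [sub_eq_zero.1 this]
  by_contra hne
  obtain ⟨u, hu⟩ := h1.cover _
    (degree_mem_lmSet (m := m) (I.sub_mem (h1.subset hg) (h1'.subset hg')) hne)
  set t := m.degree (g - g') with ht
  have htc : (g - g').coeff t ≠ 0 := m.coeff_degree_ne_zero_iff.2 hne
  have htne : t ≠ m.degree g := by
    intro h
    refine htc ?_
    rw [coeff_sub, h]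
    nth_rw 2 [← hd]
    exact sub_eq_zero.2 hc
  have hcase : t ∈ g.support ∨ t ∈ g'.support := by
    rw [mem_support_iff, mem_support_iff]
    by_contra! h
    exact htc (by rw [coeff_sub, h.1, h.2, sub_zero])
  have htle : t ≼[m] m.degree g := by
    rcases hcase with h | h
    · exact m.le_degree h
    · exact (m.le_degree h).trans_eq (by rw [hd])
  have hue : u = m.degree g := by
    by_contra hue
    rcases hcase with h | h
    · exact hG.2.2.2.2 g hg t h u hu.mem hue hu
    · rw [hlm] at hu
      exact hG'.2.2.2.2 g' hg' t h u hu.mem (hd ▸ hue) hu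
  exact htne (m.toSyn.injective (htle.antisymm (m.toSyn_monotone (hue ▸ hu.le))))

lemma reduce_element (hH : IsJanetSpanning m I H) {h g : MvPolynomial (Fin n) K} (hh : h ∈ H)
    (hred : Relation.ReflTransGen (ReducesTo m (JanetDvd (lmSet m H)) (H \ {h})) h g) :
    m.degree g = m.degree h ∧ g ≠ 0 ∧
      Relation.ReflTransGen (JanetAutoreduceStep m) H ((H \ {h}) ∪ {g}) := by
  induction hred with
  | refl =>
    refine ⟨rfl, hH.ne_zero h hh, ?_⟩
    rw [Set.sdiff_union_of_subset (Set.singleton_subset_iff.2 hh)]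
  | tail _ hstep ih =>
    rename_i g g' _
    obtain ⟨h1, h2, h3⟩ := ih
    obtain ⟨hdeg, h0, -⟩ := hH.tail_reduces hh h1 h2 hstep
    refine ⟨hdeg, h0, h3.tail ⟨g, Or.inr rfl, g', ?_, ?_⟩⟩
    · rw [hH.lmSet_replace hh h2 h1, Set.union_sdiff_right,
        Set.sdiff_singleton_eq_self (hH.notMem_diff hh h1)]
      exact hstep
    · rw [Set.union_sdiff_right, Set.sdiff_singleton_eq_self (hH.notMem_diff hh h1),
        Set.sdiff_singleton_eq_self (a := (0 : MvPolynomial (Fin n) K)) (by simpa using h0.symm)]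

/-- Fully reducing one bad element leaves the leading monomials, hence the status of all other
elements, unchanged, so the number of bad elements drops. -/
lemma exists_isJanetAutoreduction (hH : IsJanetSpanning m I H) :
    ∃ G, IsJanetAutoreduction m H G := by
  let bad : Set (MvPolynomial (Fin n) K) → Set (MvPolynomial (Fin n) K) := fun H =>
    {h | h ∈ H ∧ ¬ ∀ t ∈ h.support, ∀ u ∈ lmSet m H, u ≠ m.degree h → ¬ JanetDvd (lmSet m H) u t}
  induction hk : (bad H).ncard using Nat.strong_induction_on generalizing H with
  | _ k ih =>
    by_cases hb : (bad H).Nonempty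
    · obtain ⟨h, hh, hbad⟩ := hb
      obtain ⟨g, hred, hnf⟩ := exists_isNormalForm (m := m) (D := JanetDvd (lmSet m H))
        (fun _ _ h => h.le) (H \ {h}) h
      obtain ⟨hdeg, h0, hsteps⟩ := hH.reduce_element hh hred
      have hlm := hH.lmSet_replace hh h0 hdeg
      have hsub : bad ((H \ {h}) ∪ {g}) ⊂ bad H := by
        refine (Set.ssubset_iff_of_subset ?_).2 ⟨h, ⟨hh, hbad⟩, ?_⟩
        · rintro f ⟨hf | rfl, hfb⟩
          · rw [hlm] at hfb
            exact ⟨hf.1, hfb⟩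
          · rw [hlm] at hfb
            refine (hfb ?_).elim
            rintro t ht u ⟨f', hf', h0', rfl⟩ hne
            refine hnf t ht _ ⟨f', ⟨hf', ?_⟩, h0', rfl⟩
            rintro rfl
            exact hne hdeg.symm
        · rintro ⟨hf | rfl, hfb⟩
          · exact hf.2 rfl
          · rw [hlm] at hfb
            refine hfb ?_
            rintro t ht u ⟨f', hf', h0', rfl⟩ hne
            refine hnf t ht _ ⟨f', ⟨hf', ?_⟩, h0', rfl⟩
            rintro rfl
            exact hne rfl
      obtain ⟨G, h1, h2⟩ := ih _ (hk ▸ Set.ncard_lt_ncard hsub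
        (hH.finite.subset fun _ h => h.1)) (hH.steps hsteps).1 rfl
      exact ⟨G, hsteps.trans h1, h2⟩
    · refine ⟨H, .refl, hH.finite, hH.ne_zero, hH.injOn, fun f hf => ?_⟩
      by_contra hc
      exact hb ⟨f, hf, hc⟩

/-- Pommaret–Janet autoreduction keeps exactly the Pommaret-minimal leading monomials. -/
lemma isPJAutoreduction_iff (hF : IsJanetSpanning m I F) {G : Set (MvPolynomial (Fin n) K)} :
    IsPJAutoreduction m F G ↔ IsJanetAutoreduction m (Involutive.pommaretMinimal m F) G := by
  constructor
  · rintro ⟨H, hl, hG⟩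
    rwa [hF.repeatLoop_iff.1 hl] at hG
  · exact fun h => ⟨_, hF.repeatLoop_iff.2 rfl, h⟩

lemma existsUnique_isPJAutoreduction (hF : IsJanetSpanning m I F) :
    ∃! G, IsPJAutoreduction m F G := by
  simp_rw [hF.isPJAutoreduction_iff]
  obtain ⟨G, hG⟩ := hF.pommaretMinimal.exists_isJanetAutoreduction
  exact ⟨G, hG, fun G' hG' =>
    (hF.pommaretMinimal.subset_of_isJanetAutoreduction hG' hG).antisymm
      (hF.pommaretMinimal.subset_of_isJanetAutoreduction hG hG')⟩

end IsJanetSpanning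

lemma exists_isMinimalJanetBasis (m : MonomialOrder (Fin n))
    (I : Ideal (MvPolynomial (Fin n) K)) : ∃ G, IsMinimalJanetBasis m I G := by
  set L := lmSet m (I : Set (MvPolynomial (Fin n) K)) with hLdef
  have hL : IsUpperSet L := isUpperSet_lmSet_ideal
  have hch : ∀ u : L, ∃ f ∈ I, f ≠ 0 ∧ m.degree f = u := fun u => u.2
  choose p hpI hp0 hpd using hch
  let F : Set (MvPolynomial (Fin n) K) := {f | ∃ u : L, (u : Fin n →₀ ℕ) ∈ minimalJanetSet L ∧
    p u = f}
  have hlm : lmSet m F = minimalJanetSet L := by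
    ext w
    constructor
    · rintro ⟨_, ⟨u, hu, rfl⟩, -, rfl⟩
      rwa [hpd]
    · exact fun hw => ⟨p ⟨w, hw.1⟩, ⟨⟨w, hw.1⟩, hw, rfl⟩, hp0 _, hpd _⟩
  have hF : IsJanetSpanning m I F := by
    refine ⟨?_, ?_, ?_, ?_, ?_⟩
    · refine (((minimalJanetSet_finite hL).preimage Subtype.val_injective.injOn).image p).subset ?_
      rintro _ ⟨u, hu, rfl⟩
      exact ⟨u, hu, rfl⟩
    · rintro _ ⟨u, -, rfl⟩
      exact hp0 u
    · rintro _ ⟨u, -, rfl⟩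
      exact hpI u
    · rintro _ ⟨u, -, rfl⟩ _ ⟨v, -, rfl⟩ h
      rw [hpd, hpd] at h
      rw [Subtype.ext h]
    · rw [hlm]
      exact fun w hw => exists_janetDvd_minimalJanetSet hL hw
  obtain ⟨G, hG⟩ := hF.exists_isJanetAutoreduction
  obtain ⟨h1, h2⟩ := hF.isJanetBasis_of_isJanetAutoreduction hG
  refine ⟨G, h1, fun F' hF' => ?_⟩
  rw [h2, hlm]
  exact minimalJanetSet_subset hL hF'.isJanetSpanning.lmSet_subset hF'.isJanetSpanning.cover

/-! ### Finite Pommaret bases -/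

/-- The leading term persists until some step cancels it, and that step supplies the divisor. -/
lemma exists_dvd_degree_of_reduces (hD : ∀ u t, D u t → u ≤ t) {g : MvPolynomial (Fin n) K}
    (h : Relation.ReflTransGen (ReducesTo m D F) g 0) (h0 : g ≠ 0) :
    ∃ u ∈ lmSet m F, D u (m.degree g) := by
  induction h using Relation.ReflTransGen.head_induction_on with
  | refl => exact (h0 rfl).elim
  | head hstep _ ih =>
    rename_i a b _
    obtain ⟨t, ht, hu, -, hts⟩ := hstep.exists_term hD
    by_cases hta : t = m.degree a
    · rwa [← hta]
    have hlt : t ≺[m] m.degree a :=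
      lt_of_le_of_ne (m.le_degree ht) fun h => hta (m.toSyn.injective h)
    have hmem : m.degree a ∈ b.support := by
      rw [mem_support_iff, hts _ hlt]
      exact m.coeff_degree_ne_zero_iff.2 h0
    have hdeg : m.degree b = m.degree a := by
      refine m.toSyn.injective (le_antisymm (m.degree_le_iff.2 fun s hs => ?_)
        (m.le_degree hmem))
      by_contra! hs'
      refine mem_support_iff.1 hs ?_
      rw [hts s (hlt.trans hs'), m.coeff_eq_zero_of_lt hs']
    rw [← hdeg]
    refine ih ?_
    rintro rfl
    simp at hmem

/-- The Pommaret cones of a finite Pommaret basis cover the leading monomials of the ideal. -/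
lemma IsPommaretBasis.exists_pommaretDvd (hF : IsPommaretBasis m I F) (hfin : F.Finite)
    {w : Fin n →₀ ℕ} (hw : w ∈ lmSet m (I : Set (MvPolynomial (Fin n) K))) :
    ∃ u ∈ lmSet m F, PommaretDvd u w := by
  obtain ⟨⟨h0, hinj, hauto⟩, hspan, hloc⟩ := hF
  have hU : ∀ u ∈ lmSet m F, ∀ v ∈ lmSet m F, PommaretDvd u v → u = v := by
    rintro u hu _ ⟨f, hf, hf0, rfl⟩ hd
    by_contra hne
    exact hauto f hf _ (m.degree_mem_support hf0) u hu hne hd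
  have hPJ : ∀ u ∈ lmSet m F, ∀ t, PommaretDvd u t → JanetDvd (lmSet m F) u t :=
    fun u hu t hd => janetDvd_iff.2 ⟨hu, hd.le, fun i hi =>
      ((pommaretDvd_iff.1 hd).2 i hi).janetMult (hU u hu)⟩
  have hlocJ : ∀ f ∈ F, ∀ i : Fin n, ¬ JanetMult (lmSet m F) (m.degree f) i →
      IsJanetNF m F (f * X i) 0 := fun f hf i hi =>
    ⟨Relation.ReflTransGen.mono (fun _ _ h => ReducesTo.mono hPJ h) _ _ (hloc f hf i fun hp =>
      hi (hp.janetMult (hU _ (degree_mem_lmSet hf (h0 f hf))))).1, by simp⟩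
  rw [← hspan] at hw
  obtain ⟨u, hu⟩ := exists_janetDvd_of_local hfin h0 hinj hlocJ hw
  refine ⟨u, hu.mem, pommaretDvd_iff.2 ⟨hu.le, fun i hi => ?_⟩⟩
  -- Reducing `f * X i` to 0 yields a Pommaret, hence Janet, divisor of its leading monomial. By
  -- uniqueness this is the leading monomial of `f`, so `x_i` is Pommaret multiplicative after all.
  by_contra hp
  obtain ⟨f, hf, hf0, rfl⟩ := hu.mem
  have hX : m.degree (f * X i) = m.degree f + Finsupp.single i 1 := by
    rw [m.degree_mul hf0 (by simp), m.degree_X]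
  obtain ⟨v, hv, hvd⟩ := exists_dvd_degree_of_reduces (fun _ _ h => h.le) (hloc f hf i hp).1
    (mul_ne_zero hf0 (by simp))
  rw [hX] at hvd
  have hfd : JanetDvd (lmSet m F) (m.degree f) (m.degree f + Finsupp.single i 1) := by
    refine ⟨hu.mem, _, rfl, fun j hj => ?_⟩
    obtain rfl : j = i := by simpa using Finsupp.support_single_subset hj
    exact hu.mult hi
  obtain rfl := (hPJ v hv _ hvd).unique hfd
  exact hp ((pommaretDvd_iff.1 hvd).2 i (by simp))

lemma IsJanetBasis.isPommaretBasis_of_mult_iff (hF : IsJanetBasis m I F)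
    (h : ∀ u ∈ lmSet m F, ∀ i, JanetMult (lmSet m F) u i ↔ PommaretMult u i) :
    IsPommaretBasis m I F := by
  have hiff : ∀ u ∈ lmSet m F, ∀ t, JanetDvd (lmSet m F) u t ↔ PommaretDvd u t := by
    intro u hu t
    rw [janetDvd_iff, pommaretDvd_iff]
    simp [hu, h u hu]
  refine ⟨⟨hF.1.2.1, hF.1.2.2.1, fun f hf t ht u hu hne hd =>
    hF.1.2.2.2 f hf t ht u hu hne ((hiff u hu t).2 hd)⟩, hF.2.1, fun f hf i hi => ?_⟩
  have hJ := hF.2.2 f hf i fun hj => hi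
    ((h _ (degree_mem_lmSet hf (hF.1.2.1 f hf)) i).1 hj)
  exact ⟨Relation.ReflTransGen.mono
    (fun _ _ h => ReducesTo.mono (fun u hu t => (hiff u hu t).1) h) _ _ hJ.1, by simp⟩

/-- If `I` has a finite Pommaret basis, then every Janet basis of `I` whose leading monomials are
Pommaret autoreduced is a Pommaret basis. -/
lemma IsPommaretBasis.of_isJanetBasis {P : Set (MvPolynomial (Fin n) K)}
    (hP : IsPommaretBasis m I P) (hfin : P.Finite) (hF : IsJanetBasis m I F)
    (hU : ∀ u ∈ lmSet m F, ∀ v ∈ lmSet m F, PommaretDvd u v → u = v) :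
    IsPommaretBasis m I F := by
  have hS := hF.isJanetSpanning
  refine hF.isPommaretBasis_of_mult_iff fun u hu i => ⟨fun hi => ?_, fun hi =>
    hi.janetMult (hU u hu)⟩
  exact JanetMult.pommaretMult isUpperSet_lmSet_ideal (lmSet_finite hfin)
    (lmSet_mono (hP.2.1 ▸ Ideal.subset_span)) (fun w hw => hP.exists_pommaretDvd hfin hw)
    hS.lmSet_subset hS.cover hU hu hi

/-- The Pommaret-minimal part of `G` autoreduces to a Janet basis, so minimality puts all of `lmSet
m G` inside that part. -/
lemma IsMinimalJanetBasis.eq_of_pommaretDvd {G : Set (MvPolynomial (Fin n) K)}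
    (hG : IsMinimalJanetBasis m I G) {u v : Fin n →₀ ℕ} (hu : u ∈ lmSet m G)
    (hv : v ∈ lmSet m G) (huv : PommaretDvd u v) : u = v := by
  have hS := hG.1.isJanetSpanning.pommaretMinimal
  obtain ⟨B, hB⟩ := hS.exists_isJanetAutoreduction
  obtain ⟨h1, h2⟩ := hS.isJanetBasis_of_isJanetAutoreduction hB
  have hsub := hG.2 B h1
  rw [h2] at hsub
  exact eq_of_pommaretDvd_pommaretMinimal (hsub hu) (hsub hv) huv

end Involutive

theorem theorem1 {K : Type*} [Field K] {n : ℕ} (m : MonomialOrder (Fin n))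
    (hm : ∀ i j : Fin n, i < j → Finsupp.single j 1 ≺[m] Finsupp.single i 1)
    (I : Ideal (MvPolynomial (Fin n) K)) :
    (∃ G, Involutive.IsMinimalJanetBasis m I G) ∧
    (∀ F, Involutive.IsJanetBasis m I F → ∃! G, Involutive.IsPJAutoreduction m F G) ∧
    List.TFAE [
      ∃ G, G.Finite ∧ Involutive.IsPommaretBasis m I G,
      ∀ G, Involutive.IsMinimalJanetBasis m I G → Involutive.IsPommaretBasis m I G,
      ∀ F, Involutive.IsJanetBasis m I F →
        ∀ G, Involutive.IsPJAutoreduction m F G → Involutive.IsPommaretBasis m I G] := by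
  obtain ⟨G₀, hG₀⟩ := Involutive.exists_isMinimalJanetBasis m I
  refine ⟨⟨G₀, hG₀⟩, fun F hF => hF.isJanetSpanning.existsUnique_isPJAutoreduction, ?_⟩
  tfae_have 1 → 2
  | ⟨P, hfin, hP⟩, G, hG => hP.of_isJanetBasis hfin hG.1 fun u hu v hv => hG.eq_of_pommaretDvd hu hv
  tfae_have 2 → 1 := fun h => ⟨G₀, hG₀.1.1.1, h G₀ hG₀⟩
  tfae_have 1 → 3 := by
    rintro ⟨P, hfin, hP⟩ F hF G hG
    have hS := hF.isJanetSpanning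
    obtain ⟨h1, h2⟩ := hS.pommaretMinimal.isJanetBasis_of_isJanetAutoreduction
      (hS.isPJAutoreduction_iff.1 hG)
    refine hP.of_isJanetBasis hfin h1 ?_
    rw [h2]
    exact fun u hu v hv => Involutive.eq_of_pommaretDvd_pommaretMinimal hu hv
  tfae_have 3 → 1 := by
    intro h
    have hS := hG₀.1.isJanetSpanning
    obtain ⟨G, hG, -⟩ := hS.existsUnique_isPJAutoreduction
    obtain ⟨h1, -⟩ := hS.pommaretMinimal.isJanetBasis_of_isJanetAutoreduction
      (hS.isPJAutoreduction_iff.1 hG)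
    exact ⟨G, h1.1.1, h G₀ hG₀.1 G hG⟩
  tfae_finish
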